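/- **Trapped Regular Point Theorem.** Let $V$ be a finite set of points (the *regular points*) in the Euclidean plane and let $S$ be a Steiner minimal tree for $V$, i.e. a shortest network (finite connected graph with straight edges, whose vertices are points of the plane and include $V$) interconnecting $V$; its vertices outside $V$ are called *Steiner points*. A *Steiner spiral chain* in $S$ is a sequence of vertices $A_0,A_1,\dots,A_n$ ($n\ge 1$) of $S$, consecutive ones joined by edges of $S$, such that $A_1,\dots,A_{n-1}$ are Steiner points at each of which the chain turns clockwise by $60^\circ$ (so $\angle A_{i-1}A_iA_{i+1}=120^\circ$), and $A_n$ is a regular point. Put $a_i=|A_{i-1}A_i|$ for $1\le i\le n$, let the scale be normalized by $a_1=1$, and let $\boldsymbol w=(a_1,\dots,a_n)$. For $0\le u<s\le v\le n$, the *Type A condition* $C^A_{u,v,s}$ is the inequality $|A_uA_v|\ge a_s$. For $0\le u<s\le v<\min(6,n)$, let $H=H_{u,v}$ be the orthogonal projection of $A_u$ onto the line $A_vA_{v+1}$; the *Type B condition* $C^B_{u,v,s}$ says that $H$ lies on the ray $A_vA_{v+1}$ (from $A_v$ through $A_{v+1}$) and $|A_uH|<a_s$. Both conditions depend only on $\boldsymbol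 w$, and are regarded as conditions on an arbitrary vector $\boldsymbol w$ with $a_1=1$ and all $a_i>0$, through the polygonal chain with edge lengths $a_1,\dots,a_n$ that turns clockwise by $60^\circ$ at each interior vertex. Fix $n$, let $\{C^A_i\}_{i=1}^k$ be any set of Type A conditions and $\{C^B_j\}_{j=1}^l$ any set of Type B conditions, and let $C$ be a linear constraint on $\boldsymbol w$ (a finite system of strict or non-strict affine-linear inequalities in $a_1,\dots,a_n$) such that, for all $\boldsymbol w$ with $a_1=1$ and all $a_i>0$, $$C\wedge\bigwedge_{i=1}^k C^A_i\ \Longrightarrow\ \bigvee_{j=1}^l C^B_j .$$ Then for every Steiner spiral chain $A_0,\dots,A_n$ in a Steiner minimal tree whose vector $\boldsymbol w$ of edge lengths satisfies $C$, at least one of the conditions $C^B_j$ holds, and for every $C^B_j=C^B_{u,v,s}$ that holds, the regular point $A_n$ lies in the closed bounded region enclosed by the polygon $A_uA_{u+1}\cdots A_vHA_u$ (the closed polygonal curve together with the bounded components of its complement). -/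

import Mathlib

/-! The Euclidean plane is `ℂ`. -/

noncomputable section

namespace SteinerSpiral

/-- Euclidean length of the straight edge joining two points of the plane. -/
def segLength (e : Sym2 ℂ) : ℝ :=
  Sym2.lift ⟨fun x y => dist x y, fun x y => dist_comm x y⟩ e

/-- A network interconnecting the finite set `V` of regular points: a finite connected graph,
drawn with straight edges, whose vertex set is a finite set of points of the plane containing
`V`; the vertices outside `V` are the auxiliary (Steiner) vertices. -/
structure Network (V : Finset ℂ) where
  verts : Finset ℂ
  edges : Finset (Sym2 ℂ)
  regular_mem : V ⊆ verts
  mem_verts : ∀ e ∈ edges, ∀ x ∈ e, x ∈ verts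
  loopless : ∀ e ∈ edges, ¬ e.IsDiag
  connected : ∀ x ∈ verts, ∀ y ∈ verts,
    (SimpleGraph.fromEdgeSet (edges : Set (Sym2 ℂ))).Reachable x y

/-- Total Euclidean length of a network. -/
def Network.length {V : Finset ℂ} (N : Network V) : ℝ := ∑ e ∈ N.edges, segLength e

/-- A Steiner minimal tree for `V` is a shortest network interconnecting `V`. All edges have
positive length, so a shortest network has no cycle: it is a tree. -/
def Network.IsSteinerMinimalTree {V : Finset ℂ} (N : Network V) : Prop :=
  ∀ N' : Network V, N.length ≤ N'.length

/-- Rotation factor of a clockwise turn by `60°`. -/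
def turnRight : ℂ := Complex.exp (-(Real.pi / 3 : ℝ) * Complex.I)

/-- `A 0, …, A n` is a Steiner spiral chain of the network `N`: it follows edges of `N`,
`A 1, …, A (n - 1)` are Steiner points at each of which the chain turns clockwise by `60°`
(so that the angle between consecutive edges is `120°`), it ends at the regular point `A n`,
and the first edge has length `1`. Only the values `A i` with `i ≤ n` are relevant. -/
structure IsSpiralChain {V : Finset ℂ} (N : Network V) (n : ℕ) (A : ℕ → ℂ) : Prop where
  pos : 1 ≤ n
  edge : ∀ i < n, s(A i, A (i + 1)) ∈ N.edges
  steiner : ∀ i, 1 ≤ i → i < n → A i ∉ V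
  regular : A n ∈ V
  turn : ∀ i, 1 ≤ i → i < n →
    SameRay ℝ (turnRight * (A i - A (i - 1))) (A (i + 1) - A i)
  normalized : dist (A 0) (A 1) = 1

/-- The edge lengths `a i = |A (i - 1) A i|`, for `1 ≤ i ≤ n`, of a chain `A`. -/
def edgeLengths (A : ℕ → ℂ) : ℕ → ℝ := fun i => dist (A (i - 1)) (A i)

/-- Normalized edge-length vectors `(a 1, …, a n)`; the values of `a` outside `{1, …, n}`
are irrelevant. -/
def edgeVectors (n : ℕ) : Set (ℕ → ℝ) :=
  {a | a 1 = 1 ∧ ∀ i, 1 ≤ i → i ≤ n → 0 < a i}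

/-- The chain with edge lengths `a 1, a 2, …` placed in standard position:
it starts at `0`, its first edge points along the positive real axis,
and it turns clockwise by `60°` at every later vertex. -/
def spiral (a : ℕ → ℝ) (k : ℕ) : ℂ :=
  ∑ i ∈ Finset.range k, (a (i + 1) : ℂ) * turnRight ^ i

/-- A linear constraint on `(a 1, …, a n)`: a finite system of (strict or non-strict)
affine-linear inequalities. -/
def IsLinearConstraint (n : ℕ) (C : Set (ℕ → ℝ)) : Prop :=
  ∃ (m : ℕ) (c : Fin m → ℕ → ℝ) (b : Fin m → ℝ) (strict : Set (Fin m)),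
    C = {a | ∀ k, (k ∈ strict → ∑ i ∈ Finset.Icc 1 n, c k i * a i < b k) ∧
                  (k ∉ strict → ∑ i ∈ Finset.Icc 1 n, c k i * a i ≤ b k)}

/-- The triple `(u, v, s)` indexing a condition. -/
structure Index where
  u : ℕ
  v : ℕ
  s : ℕ

/-- Indices of the Type A conditions of a chain with `n` edges. -/
def indexA (n : ℕ) : Set Index := {t | t.u < t.s ∧ t.s ≤ t.v ∧ t.v ≤ n}

/-- Indices of the Type B conditions of a chain with `n` edges. -/
def indexB (n : ℕ) : Set Index := {t | t.u < t.s ∧ t.s ≤ t.v ∧ t.v < min 6 n}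

/-- The Type A condition `|A_u A_v| ≥ a_s`. -/
def CondA (A : ℕ → ℂ) (t : Index) : Prop := edgeLengths A t.s ≤ dist (A t.u) (A t.v)

/-- The orthogonal projection `H` of `A_u` onto the line through `A_v` and `A_{v+1}`. -/
def foot (A : ℕ → ℂ) (t : Index) : ℂ :=
  EuclideanGeometry.orthogonalProjection line[ℝ, A t.v, A (t.v + 1)] (A t.u)

/-- The closed ray from `p` through `q`. -/
def ray (p q : ℂ) : Set ℂ := {z | ∃ r : ℝ, 0 ≤ r ∧ z = AffineMap.lineMap p q r}

/-- The Type B condition: `H` lies on the ray `A_v A_{v+1}` and `|A_u H| < a_s`. -/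
def CondB (A : ℕ → ℂ) (t : Index) : Prop :=
  foot A t ∈ ray (A t.v) (A (t.v + 1)) ∧ dist (A t.u) (foot A t) < edgeLengths A t.s

/-- The closed polygonal curve `A_u A_{u+1} … A_v H A_u`. -/
def polygonCurve (A : ℕ → ℂ) (t : Index) : Set ℂ :=
  (⋃ i ∈ Set.Ico t.u t.v, segment ℝ (A i) (A (i + 1))) ∪
    segment ℝ (A t.v) (foot A t) ∪ segment ℝ (foot A t) (A t.u)

/-- The closed region enclosed by a curve `Γ` in the plane: `Γ` together with the bounded
connected components of its complement. For a simple closed polygon this is the polygon with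
its interior. -/
def enclosedRegion (Γ : Set ℂ) : Set ℂ :=
  Γ ∪ {z | z ∈ Γᶜ ∧ Bornology.IsBounded (connectedComponentIn Γᶜ z)}

/-- The closed polygonal region `A_u A_{u+1} … A_v H`. -/
def polygonRegion (A : ℕ → ℂ) (t : Index) : Set ℂ := enclosedRegion (polygonCurve A t)

end SteinerSpiral

end

/-! ### Exchange arguments in a minimal network -/

namespace SteinerSpiral

open SimpleGraph

/-! Everything metric comes from exchange. Deleting the chain edge `A_{s-1}A_s` separates `A_u` from
`A_v` along the chain, and the segment `A_uA_v` reconnects them, so minimality gives `|A_uA_v| ≥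
a_s`: every Type A condition holds automatically (`IsSpiralChain.condA_spiral`). The hypothesis on
vectors therefore applies to the actual edge lengths and yields a Type B condition, which a rigid
motion carries from the standard chain `spiral` to `A`.

The same exchange with `A_v` replaced by a point `P` of a later edge
(`IsSpiralChain.dist_le_dist_of_mem_segment`) gives `|A_uP| ≥ a_s`. When Type B holds, `|A_uH| <
a_s`, so no edge from `A_vA_{v+1}` on can meet the segment `A_uH`. It also shows that
non-consecutive edges are disjoint. The remainder of the chain thus starts on the polygon and cannot
cross out through any of its sides.

To turn this into containment without the Jordan curve theorem, the region is written with
half-planes: to the right of the edges, and bounded by the perpendicular. Because the chain always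
turns right, the half-planes of the two neighbouring edges cut the line of an edge down to that edge
itself, so leaving a half-plane would mean crossing an edge (`IsTurningChain.trapped`). For `v - u`
equal to 2, 3 or 4 the region is convex; for `v - u = 5` it need not be and is a union of pieces;
for `v - u = 1` the foot falls behind `A_v` and Type B fails. -/

theorem segLength_mk (x y : ℂ) : segLength s(x, y) = dist x y := rfl

theorem segLength_nonneg (e : Sym2 ℂ) : 0 ≤ segLength e := by
  induction e with | h x y => exact dist_nonneg (x := x) (y := y)

/-- Only an inequality, since an edge added in an exchange may already be present. -/
theorem sum_segLength_insert_le (e : Sym2 ℂ) (E : Finset (Sym2 ℂ)) :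
    ∑ f ∈ insert e E, segLength f ≤ segLength e + ∑ f ∈ E, segLength f := by
  by_cases h : e ∈ E
  · rw [Finset.insert_eq_of_mem h]
    linarith [segLength_nonneg e]
  · rw [Finset.sum_insert h]

theorem reachable_fromEdgeSet {E : Set (Sym2 ℂ)} {x y : ℂ} (h : s(x, y) ∈ E) :
    (fromEdgeSet E).Reachable x y := by
  by_cases hxy : x = y
  · subst hxy; rfl
  · exact Adj.reachable ((fromEdgeSet_adj E).2 ⟨h, hxy⟩)

/-- Consecutive steps along a sequence of edges stay in one connected component. -/
theorem reachable_of_steps {E : Set (Sym2 ℂ)} {A : ℕ → ℂ} {i j : ℕ} (hij : i ≤ j)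
    (h : ∀ k, i ≤ k → k < j → s(A k, A (k + 1)) ∈ E) :
    (fromEdgeSet E).Reachable (A i) (A j) := by
  induction j, hij using Nat.le_induction with
  | base => rfl
  | succ j hij ih =>
    exact (ih fun k h1 h2 => h k h1 (by omega)).trans
      (reachable_fromEdgeSet (h j hij (by omega)))

/-- A minimal network is no longer than any edge set, with at most one extra vertex `P`, that
connects the ends of all its edges. -/
theorem Network.IsSteinerMinimalTree.length_le {V : Finset ℂ} {N : Network V}
    (hN : N.IsSteinerMinimalTree) (P : ℂ) (E : Finset (Sym2 ℂ))
    (hE : ∀ e ∈ E, ∀ x ∈ e, x = P ∨ x ∈ N.verts)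
    (hP : ∃ x ∈ N.verts, (fromEdgeSet (E : Set (Sym2 ℂ))).Reachable x P)
    (hr : ∀ x y, s(x, y) ∈ N.edges → (fromEdgeSet (E : Set (Sym2 ℂ))).Reachable x y) :
    N.length ≤ ∑ e ∈ E, segLength e := by
  classical
  -- Loops are discarded from `E`: the extra point `P` may coincide with an existing vertex, which
  -- makes some new edges degenerate. Connectivity is unaffected.
  have hle : fromEdgeSet (E : Set (Sym2 ℂ)) ≤
      fromEdgeSet ((E.filter fun e => ¬ e.IsDiag : Finset (Sym2 ℂ)) : Set (Sym2 ℂ)) := by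
    intro x y h
    rw [fromEdgeSet_adj] at h ⊢
    refine ⟨?_, h.2⟩
    simpa using h
  have hN' : ∀ x y, (fromEdgeSet (N.edges : Set (Sym2 ℂ))).Reachable x y →
      (fromEdgeSet (E : Set (Sym2 ℂ))).Reachable x y := by
    rintro x y ⟨w⟩
    induction w with
    | nil => rfl
    | cons h _ ih => exact (hr _ _ ((fromEdgeSet_adj _).1 h).1).trans ih
  obtain ⟨x₀, hx₀, hxP⟩ := hP
  have hbase : ∀ x ∈ insert P N.verts, (fromEdgeSet (E : Set (Sym2 ℂ))).Reachable x₀ x := by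
    intro x hx
    rcases Finset.mem_insert.1 hx with rfl | hx
    · exact hxP
    · exact hN' _ _ (N.connected _ hx₀ _ hx)
  let N' : Network V :=
    { verts := insert P N.verts
      edges := E.filter fun e => ¬ e.IsDiag
      regular_mem := N.regular_mem.trans (Finset.subset_insert _ _)
      mem_verts := fun e he x hx =>
        Finset.mem_insert.2 (hE e (Finset.mem_filter.1 he).1 x hx)
      loopless := fun e he => (Finset.mem_filter.1 he).2
      connected := fun x hx y hy => ((hbase x hx).symm.trans (hbase y hy)).mono hle }
  refine (hN N').trans ?_
  exact Finset.sum_le_sum_of_subset_of_nonneg (Finset.filter_subset _ _)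
    fun e _ _ => segLength_nonneg e

theorem sum_segLength_erase {V : Finset ℂ} (N : Network V) {e : Sym2 ℂ} (he : e ∈ N.edges)
    [DecidableEq (Sym2 ℂ)] :
    segLength e + ∑ f ∈ N.edges.erase e, segLength f = N.length :=
  Finset.add_sum_erase _ _ he

/-! ### Injectivity and metric inequalities of spiral chains -/

section Chain

variable {V : Finset ℂ} {N : Network V} {n : ℕ} {A : ℕ → ℂ}

theorem IsSpiralChain.mem_verts (hA : IsSpiralChain N n A) {i : ℕ} (hi : i ≤ n) :
    A i ∈ N.verts := by
  have hn := hA.pos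
  rcases Nat.lt_or_ge i n with h | h
  · exact N.mem_verts _ (hA.edge i h) _ (Sym2.mem_mk_left _ _)
  · obtain ⟨k, rfl⟩ : ∃ k, i = k + 1 := ⟨i - 1, by omega⟩
    exact N.mem_verts _ (hA.edge k (by omega)) _ (Sym2.mem_mk_right _ _)

theorem IsSpiralChain.ne_succ (hA : IsSpiralChain N n A) {i : ℕ} (hi : i < n) :
    A i ≠ A (i + 1) := by
  have := N.loopless _ (hA.edge i hi)
  simpa using this

theorem turnRight_eq : turnRight = ⟨1 / 2, -(√3 / 2)⟩ := by
  have h : (-(Real.pi / 3 : ℝ) * Complex.I : ℂ) = ((-(Real.pi / 3) : ℝ) : ℂ) * Complex.I := by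
    push_cast; ring
  rw [turnRight, h, Complex.exp_mul_I, ← Complex.ofReal_cos, ← Complex.ofReal_sin]
  apply Complex.ext <;> simp

theorem norm_turnRight : ‖turnRight‖ = 1 := by
  have h : (-(Real.pi / 3 : ℝ) * Complex.I : ℂ) = ((-(Real.pi / 3) : ℝ) : ℂ) * Complex.I := by
    push_cast; ring
  rw [turnRight, h, Complex.norm_exp_ofReal_mul_I]

/-- The edges of a spiral chain have the directions of the successive powers of `turnRight`. -/
theorem IsSpiralChain.sub_eq (hA : IsSpiralChain N n A) {i : ℕ} (hi : i < n) :
    A (i + 1) - A i = (edgeLengths A (i + 1) : ℂ) * ((A 1 - A 0) * turnRight ^ i) := by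
  induction i with
  | zero =>
    have := hA.normalized
    simp [edgeLengths, this]
  | succ i ih =>
    have h1 := ih (by omega)
    have h2 := hA.turn (i + 1) (by omega) hi
    simp only [Nat.add_sub_cancel] at h2
    have h3 := h2.norm_smul_eq
    have hpos : 0 < edgeLengths A (i + 1) := by
      simpa [edgeLengths] using dist_pos.2 (hA.ne_succ (show i < n by omega))
    have h4 : ‖turnRight * (A (i + 1) - A i)‖ = edgeLengths A (i + 1) := by
      rw [norm_mul, norm_turnRight, one_mul, ← dist_eq_norm, _root_.dist_comm]
      simp [edgeLengths]
    have h5 : ‖A (i + 1 + 1) - A (i + 1)‖ = edgeLengths A (i + 1 + 1) := by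
      rw [← dist_eq_norm, _root_.dist_comm]
      simp [edgeLengths]
    rw [h4, h5, h1, Complex.real_smul, Complex.real_smul] at h3
    have h6 : (edgeLengths A (i + 1) : ℂ) ≠ 0 := by exact_mod_cast hpos.ne'
    apply mul_left_cancel₀ h6
    rw [h3]; ring

theorem IsSpiralChain.edgeLengths_pos (hA : IsSpiralChain N n A) {i : ℕ} (hi : i < n) :
    0 < edgeLengths A (i + 1) := by
  simpa [edgeLengths] using dist_pos.2 (hA.ne_succ hi)

theorem IsSpiralChain.ne_of_add_two (hA : IsSpiralChain N n A) {i : ℕ} (hi : i + 2 ≤ n) :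
    A i ≠ A (i + 2) := by
  intro h
  have h1 := hA.sub_eq (show i < n by omega)
  have h2 := hA.sub_eq (show i + 1 < n by omega)
  have p1 := hA.edgeLengths_pos (show i < n by omega)
  have p2 := hA.edgeLengths_pos (show i + 1 < n by omega)
  have h10 : A 1 - A 0 ≠ 0 := sub_ne_zero.2 (hA.ne_succ (show 0 < n by omega)).symm
  have ht : turnRight ≠ 0 := norm_ne_zero_iff.1 (by rw [norm_turnRight]; exact one_ne_zero)
  have h3 : ((A 1 - A 0) * turnRight ^ i) *
      (edgeLengths A (i + 1) + edgeLengths A (i + 1 + 1) * turnRight) = 0 := by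
    have : (A (i + 1 + 1) - A (i + 1)) + (A (i + 1) - A i) = 0 := by
      rw [h]; ring
    rw [h1, h2] at this
    rw [← this]; ring
  rcases mul_eq_zero.1 h3 with h4 | h4
  · exact (mul_ne_zero h10 (pow_ne_zero _ ht)) h4
  -- The real part of `a + b * turnRight` is `a + b / 2`, positive for positive lengths.
  · have := congrArg Complex.re h4
    simp [turnRight_eq] at this
    linarith

/-- A first repetition would close a cycle in the network, and deleting its last edge would leave a
shorter connected one. -/
theorem IsSpiralChain.injOn (hN : N.IsSteinerMinimalTree) (hA : IsSpiralChain N n A) :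
    ∀ j ≤ n, ∀ i < j, A i ≠ A j := by
  classical
  intro j
  induction j using Nat.strong_induction_on with
  | _ j ih =>
  intro hj i hi heq
  have hinj : ∀ k l, k < j → l < j → A k = A l → k = l := by
    intro k l hk hl h
    by_contra hne
    rcases Nat.lt_or_gt_of_ne hne with h' | h'
    · exact ih l hl (by omega) k h' h
    · exact ih k hk (by omega) l h' h.symm
  obtain ⟨m, rfl⟩ : ∃ m, j = m + 1 := ⟨j - 1, by omega⟩
  -- A genuine cycle needs at least three edges: a loop and an immediate return are excluded
  -- separately, for otherwise the deleted edge could be the whole return path.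
  have him : i ≠ m := by
    rintro rfl; exact hA.ne_succ (by omega) heq
  have him' : i + 1 ≠ m := by
    rintro rfl; exact hA.ne_of_add_two (by omega) heq
  have he := hA.edge m (by omega)
  have key : (fromEdgeSet ((N.edges.erase s(A m, A (m + 1)) : Finset _) : Set (Sym2 ℂ))).Reachable
      (A i) (A m) := by
    apply reachable_of_steps (by omega)
    intro k h1 h2
    rw [Finset.mem_coe, Finset.mem_erase]
    refine ⟨?_, hA.edge k (by omega)⟩
    rw [← heq]
    intro h
    rcases Sym2.eq_iff.1 h with ⟨h, h'⟩ | ⟨h, h'⟩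
    · have := hinj _ _ (by omega) (by omega) h; omega
    · have := hinj _ _ (by omega) (by omega) h
      have := hinj _ _ (by omega) (by omega) h'
      omega
  have hle := hN.length_le (A m) (N.edges.erase s(A m, A (m + 1)))
    (fun e he x hx => Or.inr (N.mem_verts e (Finset.mem_of_mem_erase he) x hx))
    ⟨A m, hA.mem_verts (by omega), by rfl⟩ (by
      intro x y hxy
      by_cases h : s(x, y) = s(A m, A (m + 1))
      · rw [← heq] at h
        rcases Sym2.eq_iff.1 h with ⟨rfl, rfl⟩ | ⟨rfl, rfl⟩
        · exact key.symm
        · exact key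
      · exact reachable_fromEdgeSet (Finset.mem_coe.2 (Finset.mem_erase.2 ⟨h, hxy⟩)))
  have := sum_segLength_erase N he
  rw [segLength_mk] at this
  have := dist_pos.2 (hA.ne_succ (show m < n by omega))
  linarith

theorem IsSpiralChain.eq_of_eq (hN : N.IsSteinerMinimalTree) (hA : IsSpiralChain N n A)
    {k l : ℕ} (hk : k ≤ n) (hl : l ≤ n) (h : A k = A l) : k = l := by
  by_contra hne
  rcases Nat.lt_or_gt_of_ne hne with h' | h'
  · exact hA.injOn hN l hl k h' h
  · exact hA.injOn hN k hk l h' h.symm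

theorem IsSpiralChain.edge_ne (hN : N.IsSteinerMinimalTree) (hA : IsSpiralChain N n A)
    {k l : ℕ} (hk : k < n) (hl : l < n) (hkl : k ≠ l) :
    s(A k, A (k + 1)) ≠ s(A l, A (l + 1)) := by
  intro h
  rcases Sym2.eq_iff.1 h with ⟨h, h'⟩ | ⟨h, h'⟩
  · exact hkl (hA.eq_of_eq hN (by omega) (by omega) h)
  · have := hA.eq_of_eq hN (by omega) (by omega) h
    have := hA.eq_of_eq hN (by omega) (by omega) h'
    omega

/-- Exchanging the edge `A_s A_{s+1}` for `A_u A_v` does not shorten a minimal network. -/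
theorem IsSpiralChain.dist_le_dist (hN : N.IsSteinerMinimalTree) (hA : IsSpiralChain N n A)
    {u v s : ℕ} (hus : u ≤ s) (hsv : s < v) (hv : v ≤ n) :
    dist (A s) (A (s + 1)) ≤ dist (A u) (A v) := by
  classical
  set E : Finset (Sym2 ℂ) := insert s(A u, A v) (N.edges.erase s(A s, A (s + 1))) with hE
  have hmem : ∀ e ∈ N.edges, e ≠ s(A s, A (s + 1)) → e ∈ (E : Set (Sym2 ℂ)) := by
    intro e he hne
    exact Finset.mem_coe.2 (Finset.mem_insert_of_mem (Finset.mem_erase.2 ⟨hne, he⟩))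
  have huv : (fromEdgeSet (E : Set (Sym2 ℂ))).Reachable (A u) (A v) :=
    reachable_fromEdgeSet (Finset.mem_coe.2 (Finset.mem_insert_self _ _))
  -- The chain edges are distinct, so the pieces before and after the deleted edge survive.
  have h1 : (fromEdgeSet (E : Set (Sym2 ℂ))).Reachable (A u) (A s) :=
    reachable_of_steps hus fun k hk hk' =>
      hmem _ (hA.edge k (by omega)) (hA.edge_ne hN (by omega) (by omega) (by omega))
  have h2 : (fromEdgeSet (E : Set (Sym2 ℂ))).Reachable (A (s + 1)) (A v) :=
    reachable_of_steps (by omega) fun k hk hk' =>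
      hmem _ (hA.edge k (by omega)) (hA.edge_ne hN (by omega) (by omega) (by omega))
  have key := (h1.symm.trans huv).trans h2.symm
  have hle := hN.length_le (A u) E (by
      intro e he x hx
      rcases Finset.mem_insert.1 he with rfl | he
      · rcases Sym2.mem_iff.1 hx with rfl | rfl
        · exact Or.inl rfl
        · exact Or.inr (hA.mem_verts hv)
      · exact Or.inr (N.mem_verts e (Finset.mem_of_mem_erase he) x hx))
    ⟨A u, hA.mem_verts (by omega), by rfl⟩ (by
      intro x y hxy
      by_cases h : s(x, y) = s(A s, A (s + 1))
      · rcases Sym2.eq_iff.1 h with ⟨rfl, rfl⟩ | ⟨rfl, rfl⟩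
        · exact key
        · exact key.symm
      · exact reachable_fromEdgeSet (hmem _ hxy h))
  have h3 := sum_segLength_erase N (hA.edge s (by omega))
  have h4 := sum_segLength_insert_le s(A u, A v) (N.edges.erase s(A s, A (s + 1)))
  rw [segLength_mk] at h3 h4
  rw [← hE] at h4
  linarith

/-- Exchanging the edge `A_s A_{s+1}` for a segment from `A_u` to a point of a later edge does
not shorten a minimal network. -/
theorem IsSpiralChain.dist_le_dist_of_mem_segment (hN : N.IsSteinerMinimalTree)
    (hA : IsSpiralChain N n A) {u s m : ℕ} (hus : u ≤ s) (hsm : s < m) (hm : m < n) {P : ℂ}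
    (hP : P ∈ segment ℝ (A m) (A (m + 1))) :
    dist (A s) (A (s + 1)) ≤ dist (A u) P := by
  classical
  set E₀ : Finset (Sym2 ℂ) := (N.edges.erase s(A s, A (s + 1))).erase s(A m, A (m + 1)) with hE₀
  set E : Finset (Sym2 ℂ) := insert s(A u, P) (insert s(A m, P) (insert s(P, A (m + 1)) E₀)) with hE
  have hmem : ∀ e ∈ N.edges, e ≠ s(A s, A (s + 1)) → e ≠ s(A m, A (m + 1)) →
      e ∈ (E : Set (Sym2 ℂ)) := by
    intro e he hne hne'
    simp only [hE, hE₀, Finset.mem_coe, Finset.mem_insert, Finset.mem_erase]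
    tauto
  have huP : (fromEdgeSet (E : Set (Sym2 ℂ))).Reachable (A u) P :=
    reachable_fromEdgeSet (by simp [hE])
  have hmP : (fromEdgeSet (E : Set (Sym2 ℂ))).Reachable (A m) P :=
    reachable_fromEdgeSet (by simp [hE])
  have hPm : (fromEdgeSet (E : Set (Sym2 ℂ))).Reachable P (A (m + 1)) :=
    reachable_fromEdgeSet (by simp [hE])
  have h1 : (fromEdgeSet (E : Set (Sym2 ℂ))).Reachable (A u) (A s) :=
    reachable_of_steps hus fun k hk hk' =>
      hmem _ (hA.edge k (by omega)) (hA.edge_ne hN (by omega) (by omega) (by omega))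
        (hA.edge_ne hN (by omega) (by omega) (by omega))
  have h2 : (fromEdgeSet (E : Set (Sym2 ℂ))).Reachable (A (s + 1)) (A m) :=
    reachable_of_steps (by omega) fun k hk hk' =>
      hmem _ (hA.edge k (by omega)) (hA.edge_ne hN (by omega) (by omega) (by omega))
        (hA.edge_ne hN (by omega) (by omega) (by omega))
  have key := ((h1.symm.trans huP).trans hmP.symm).trans h2.symm
  have key' := hmP.trans hPm
  have hle := hN.length_le P E (by
      intro e he x hx
      simp only [hE, hE₀, Finset.mem_insert, Finset.mem_erase] at he
      rcases he with rfl | rfl | rfl | ⟨-, -, he⟩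
      · rcases Sym2.mem_iff.1 hx with rfl | rfl
        · exact Or.inr (hA.mem_verts (by omega))
        · exact Or.inl rfl
      · rcases Sym2.mem_iff.1 hx with rfl | rfl
        · exact Or.inr (hA.mem_verts (by omega))
        · exact Or.inl rfl
      · rcases Sym2.mem_iff.1 hx with rfl | rfl
        · exact Or.inl rfl
        · exact Or.inr (hA.mem_verts (by omega))
      · exact Or.inr (N.mem_verts e he x hx))
    ⟨A u, hA.mem_verts (by omega), huP⟩ (by
      intro x y hxy
      by_cases h : s(x, y) = s(A s, A (s + 1))
      · rcases Sym2.eq_iff.1 h with ⟨rfl, rfl⟩ | ⟨rfl, rfl⟩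
        · exact key
        · exact key.symm
      by_cases h' : s(x, y) = s(A m, A (m + 1))
      · rcases Sym2.eq_iff.1 h' with ⟨rfl, rfl⟩ | ⟨rfl, rfl⟩
        · exact key'
        · exact key'.symm
      · exact reachable_fromEdgeSet (hmem _ hxy h h'))
  have h3 := sum_segLength_erase N (hA.edge s (by omega))
  have h4 : segLength s(A m, A (m + 1)) + ∑ f ∈ E₀, segLength f =
      ∑ f ∈ N.edges.erase s(A s, A (s + 1)), segLength f :=
    Finset.add_sum_erase _ _ (Finset.mem_erase.2
      ⟨hA.edge_ne hN hm (by omega) (by omega), hA.edge m hm⟩)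
  have h5 := sum_segLength_insert_le s(P, A (m + 1)) E₀
  have h6 := sum_segLength_insert_le s(A m, P) (insert s(P, A (m + 1)) E₀)
  have h7 := sum_segLength_insert_le s(A u, P) (insert s(A m, P) (insert s(P, A (m + 1)) E₀))
  rw [← hE] at h7
  rw [segLength_mk] at h3 h4 h5 h6 h7
  -- Splitting edge `m` at `P` costs nothing, so the balance is just `A_uP` against the deleted
  -- edge.
  have h8 := dist_add_dist_of_mem_segment hP
  linarith

/-- Non-consecutive edges of a spiral chain in a minimal network are disjoint. -/
theorem IsSpiralChain.disjoint_segments (hN : N.IsSteinerMinimalTree)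
    (hA : IsSpiralChain N n A) {i m : ℕ} (him : i + 1 < m) (hm : m < n) {P : ℂ}
    (hP : P ∈ segment ℝ (A m) (A (m + 1))) : P ∉ segment ℝ (A i) (A (i + 1)) := by
  intro hP'
  -- Exchange from both ends of edge `i`: `P` is at distance at least `a_{i+1}` from `A_i` and at
  -- least `a_{i+2}` from `A_{i+1}`. The two distances add up to `a_{i+1}`, forcing `a_{i+2} ≤ 0`.
  have h1 := hA.dist_le_dist_of_mem_segment hN (le_refl i) (by omega) hm hP
  have h2 := hA.dist_le_dist_of_mem_segment hN (le_refl (i + 1)) him hm hP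
  have h3 := dist_add_dist_of_mem_segment hP'
  have h4 := dist_pos.2 (hA.ne_succ (show i + 1 < n by omega))
  rw [_root_.dist_comm P] at h3
  linarith

end Chain

end SteinerSpiral

/-! ### Orthonormal frames, feet of perpendiculars, and transfer from the standard chain -/

namespace SteinerSpiral

/-- The component of `z - p` along the unit vector `d`. -/
def along (p d z : ℂ) : ℝ := ((z - p) * starRingEnd ℂ d).re

/-- The component of `z - p` to the left of the unit vector `d`. -/
def leftOf (p d z : ℂ) : ℝ := ((z - p) * starRingEnd ℂ d).im

theorem continuous_along (p d : ℂ) : Continuous (along p d) := by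
  unfold along; fun_prop

theorem continuous_leftOf (p d : ℂ) : Continuous (leftOf p d) := by
  unfold leftOf; fun_prop

theorem mul_conj_of_norm_eq_one {d : ℂ} (hd : ‖d‖ = 1) : d * starRingEnd ℂ d = 1 := by
  rw [Complex.mul_conj, Complex.normSq_eq_norm_sq, hd]; simp

theorem eq_add_along_leftOf {d : ℂ} (hd : ‖d‖ = 1) (p z : ℂ) :
    z = p + (along p d z + leftOf p d z * Complex.I) * d := by
  rw [along, leftOf, Complex.re_add_im, mul_assoc, mul_comm (starRingEnd ℂ d),
    mul_conj_of_norm_eq_one hd]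
  ring

theorem along_self (p d : ℂ) : along p d p = 0 := by simp [along]

theorem leftOf_self (p d : ℂ) : leftOf p d p = 0 := by simp [leftOf]

theorem along_add {d : ℂ} (hd : ‖d‖ = 1) (p q w : ℂ) (t : ℝ) :
    along p d (q + t * (d * w)) = along p d q + t * w.re := by
  have : (q + t * (d * w) - p) * starRingEnd ℂ d =
      (q - p) * starRingEnd ℂ d + t * w * (d * starRingEnd ℂ d) := by ring
  rw [along, this, mul_conj_of_norm_eq_one hd, along]
  simp

theorem leftOf_add {d : ℂ} (hd : ‖d‖ = 1) (p q w : ℂ) (t : ℝ) :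
    leftOf p d (q + t * (d * w)) = leftOf p d q + t * w.im := by
  have : (q + t * (d * w) - p) * starRingEnd ℂ d =
      (q - p) * starRingEnd ℂ d + t * w * (d * starRingEnd ℂ d) := by ring
  rw [leftOf, this, mul_conj_of_norm_eq_one hd, leftOf]
  simp

theorem add_mul_mem_segment (p w : ℂ) {a b t : ℝ} (h : t ∈ Set.uIcc a b) :
    p + t * w ∈ segment ℝ (p + a * w) (p + b * w) := by
  rw [← segment_eq_uIcc] at h
  obtain ⟨α, β, hα, hβ, hαβ, rfl⟩ := h
  refine ⟨α, β, hα, hβ, hαβ, ?_⟩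
  have : (α : ℂ) + β = 1 := by exact_mod_cast hαβ
  simp only [Complex.real_smul, smul_eq_mul, Complex.ofReal_add, Complex.ofReal_mul]
  linear_combination p * this

section Foot

variable {A : ℕ → ℂ} {t : Index} {d : ℂ} {l : ℝ}

/-- The foot of the perpendicular in terms of an orthonormal frame. -/
theorem foot_eq (hd : ‖d‖ = 1) (hl : 0 < l) (h : A (t.v + 1) = A t.v + l * d) :
    foot A t = A t.v + (along (A t.v) d (A t.u) : ℂ) * d := by
  rw [foot, EuclideanGeometry.coe_orthogonalProjection_eq_iff_mem]
  constructor
  · have h2 : A t.v + (along (A t.v) d (A t.u) : ℂ) * d =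
        AffineMap.lineMap (A t.v) (A (t.v + 1)) (along (A t.v) d (A t.u) / l) := by
      have : (l : ℂ) ≠ 0 := by exact_mod_cast hl.ne'
      rw [AffineMap.lineMap_apply, h]
      simp only [vsub_eq_sub, add_sub_cancel_left, Complex.real_smul, vadd_eq_add,
        Complex.ofReal_div]
      field_simp
      ring
    rw [h2]
    exact AffineMap.lineMap_mem_affineSpan_pair _ _ _
  · rw [direction_affineSpan, vectorSpan_pair_rev, Submodule.mem_orthogonal_singleton_iff_inner_right,
      Complex.inner, h]
    have h3 : A t.u -ᵥ (A t.v + (along (A t.v) d (A t.u) : ℂ) * d) =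
        leftOf (A t.v) d (A t.u) * Complex.I * d := by
      have := eq_add_along_leftOf hd (A t.v) (A t.u)
      rw [vsub_eq_sub]
      linear_combination this
    rw [h3]
    simp only [vsub_eq_sub, add_sub_cancel_left, map_mul, Complex.conj_ofReal]
    have : (leftOf (A t.v) d (A t.u) : ℂ) * Complex.I * d * (l * starRingEnd ℂ d) =
        leftOf (A t.v) d (A t.u) * Complex.I * l * (d * starRingEnd ℂ d) := by ring
    rw [this, mul_conj_of_norm_eq_one hd]
    simp

theorem condB_iff (hd : ‖d‖ = 1) (hl : 0 < l) (h : A (t.v + 1) = A t.v + l * d) :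
    CondB A t ↔ 0 ≤ along (A t.v) d (A t.u) ∧ |leftOf (A t.v) d (A t.u)| < edgeLengths A t.s := by
  have hd0 : d ≠ 0 := norm_ne_zero_iff.1 (by rw [hd]; exact one_ne_zero)
  have hl0 : (l : ℂ) ≠ 0 := by exact_mod_cast hl.ne'
  rw [CondB, foot_eq hd hl h]
  apply and_congr
  · constructor
    · rintro ⟨r, hr, h1⟩
      rw [AffineMap.lineMap_apply, h] at h1
      simp only [vsub_eq_sub, add_sub_cancel_left, Complex.real_smul, vadd_eq_add] at h1
      have h2 : (along (A t.v) d (A t.u) : ℂ) * d = ((r * l : ℝ) : ℂ) * d := by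
        push_cast; linear_combination h1
      have h3 := mul_right_cancel₀ hd0 h2
      have h4 : along (A t.v) d (A t.u) = r * l := by exact_mod_cast h3
      rw [h4]; positivity
    · intro h1
      refine ⟨along (A t.v) d (A t.u) / l, by positivity, ?_⟩
      rw [AffineMap.lineMap_apply, h]
      simp only [vsub_eq_sub, add_sub_cancel_left, Complex.real_smul, vadd_eq_add,
        Complex.ofReal_div]
      field_simp
      ring
  · have h3 : A t.u - (A t.v + (along (A t.v) d (A t.u) : ℂ) * d) =
        leftOf (A t.v) d (A t.u) * Complex.I * d := by
      have := eq_add_along_leftOf hd (A t.v) (A t.u)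
      linear_combination this
    rw [dist_eq_norm, h3]
    simp [hd]

end Foot

/-- `A 0, …, A n` is a chain with positive edge lengths `l 0, …, l (n - 1)` which starts in the
direction of the unit vector `e` and turns clockwise by `60°` at every interior vertex. -/
structure IsTurningChain (n : ℕ) (A : ℕ → ℂ) (e : ℂ) (l : ℕ → ℝ) : Prop where
  norm_dir : ‖e‖ = 1
  pos : ∀ i < n, 0 < l i
  succ : ∀ i < n, A (i + 1) = A i + l i * (e * turnRight ^ i)

theorem IsTurningChain.norm_dir_pow {n : ℕ} {A : ℕ → ℂ} {e : ℂ} {l : ℕ → ℝ}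
    (h : IsTurningChain n A e l) (i : ℕ) : ‖e * turnRight ^ i‖ = 1 := by
  rw [norm_mul, norm_pow, norm_turnRight, h.norm_dir]; simp

theorem IsSpiralChain.isTurningChain {V : Finset ℂ} {N : Network V} {n : ℕ} {A : ℕ → ℂ}
    (hA : IsSpiralChain N n A) :
    IsTurningChain n A (A 1 - A 0) fun i => edgeLengths A (i + 1) where
  norm_dir := by rw [← dist_eq_norm, dist_comm]; exact hA.normalized
  pos i hi := hA.edgeLengths_pos hi
  succ i hi := by rw [← hA.sub_eq hi]; ring

theorem isTurningChain_spiral {n : ℕ} {a : ℕ → ℝ} (ha : a ∈ edgeVectors n) :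
    IsTurningChain n (spiral a) 1 fun i => a (i + 1) where
  norm_dir := norm_one
  pos i hi := ha.2 (i + 1) (by omega) (by omega)
  succ i hi := by simp [spiral, Finset.sum_range_succ]

section Transfer

variable {V : Finset ℂ} {N : Network V} {n : ℕ} {A : ℕ → ℂ}

theorem IsSpiralChain.edgeLengths_mem (hA : IsSpiralChain N n A) :
    edgeLengths A ∈ edgeVectors n := by
  refine ⟨hA.normalized, fun i h1 h2 => ?_⟩
  obtain ⟨k, rfl⟩ : ∃ k, i = k + 1 := ⟨i - 1, by omega⟩
  exact hA.edgeLengths_pos (by omega)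

theorem IsSpiralChain.eq_spiral (hA : IsSpiralChain N n A) {i : ℕ} (hi : i ≤ n) :
    A i = A 0 + (A 1 - A 0) * spiral (edgeLengths A) i := by
  induction i with
  | zero => simp [spiral]
  | succ i ih =>
    rw [hA.isTurningChain.succ i (by omega),
      (isTurningChain_spiral hA.edgeLengths_mem).succ i (by omega), ih (by omega)]
    ring

theorem IsSpiralChain.dist_spiral (hA : IsSpiralChain N n A) {i j : ℕ} (hi : i ≤ n)
    (hj : j ≤ n) :
    dist (spiral (edgeLengths A) i) (spiral (edgeLengths A) j) = dist (A i) (A j) := by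
  rw [hA.eq_spiral hi, hA.eq_spiral hj, dist_eq_norm, dist_eq_norm, add_sub_add_left_eq_sub,
    ← mul_sub, norm_mul, hA.isTurningChain.norm_dir, one_mul]

theorem IsSpiralChain.edgeLengths_spiral (hA : IsSpiralChain N n A) {i : ℕ} (hi : i ≤ n) :
    edgeLengths (spiral (edgeLengths A)) i = edgeLengths A i :=
  hA.dist_spiral (by omega) hi

/-- Type A conditions hold along every spiral chain of a minimal network. -/
theorem IsSpiralChain.condA_spiral (hN : N.IsSteinerMinimalTree) (hA : IsSpiralChain N n A)
    {t : Index} (ht : t ∈ indexA n) : CondA (spiral (edgeLengths A)) t := by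
  obtain ⟨h1, h2, h3⟩ := ht
  rw [CondA, hA.edgeLengths_spiral (by omega), hA.dist_spiral (by omega) h3]
  obtain ⟨s, hs⟩ : ∃ s, t.s = s + 1 := ⟨t.s - 1, by omega⟩
  rw [hs]
  exact hA.dist_le_dist hN (by omega) (by omega) h3

theorem IsSpiralChain.condB_of_spiral (hA : IsSpiralChain N n A)
    {t : Index} (ht : t ∈ indexB n) (h : CondB (spiral (edgeLengths A)) t) : CondB A t := by
  obtain ⟨h1, h2, h3⟩ := ht
  have hvn : t.v < n := lt_of_lt_of_le h3 (min_le_right _ _)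
  have c1 := hA.isTurningChain
  have c2 := isTurningChain_spiral hA.edgeLengths_mem
  rw [condB_iff (c2.norm_dir_pow t.v) (c2.pos _ hvn) (c2.succ _ hvn)] at h
  rw [condB_iff (c1.norm_dir_pow t.v) (c1.pos _ hvn) (c1.succ _ hvn)]
  rw [hA.edgeLengths_spiral (by omega)] at h
  -- Frame coordinates are invariant under the rigid motion from `spiral` to `A`, as `|A 1 - A 0| =
  -- 1`.
  have key : (A t.u - A t.v) * starRingEnd ℂ ((A 1 - A 0) * turnRight ^ t.v) =
      (spiral (edgeLengths A) t.u - spiral (edgeLengths A) t.v) *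
        starRingEnd ℂ (1 * turnRight ^ t.v) := by
    rw [hA.eq_spiral (show t.u ≤ n by omega), hA.eq_spiral hvn.le, map_mul, one_mul]
    linear_combination (spiral (edgeLengths A) t.u - spiral (edgeLengths A) t.v) *
      starRingEnd ℂ (turnRight ^ t.v) * mul_conj_of_norm_eq_one c1.norm_dir
  unfold along leftOf at h ⊢
  rwa [key]

end Transfer

end SteinerSpiral

/-! ### Half-planes of the edges and the trapping argument -/

namespace SteinerSpiral

theorem turnRight_pow_two : turnRight ^ 2 = ⟨-(1 / 2), -(√3 / 2)⟩ := by
  have h3 : √3 * √3 = 3 := Real.mul_self_sqrt (by norm_num)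
  rw [pow_two, turnRight_eq]
  apply Complex.ext
  · rw [Complex.mul_re]; linear_combination -h3 / 4
  · rw [Complex.mul_im]; ring

theorem turnRight_pow_three : turnRight ^ 3 = -1 := by
  have h3 : √3 * √3 = 3 := Real.mul_self_sqrt (by norm_num)
  rw [pow_succ, turnRight_pow_two, turnRight_eq]
  apply Complex.ext
  · rw [Complex.mul_re, Complex.neg_re, Complex.one_re]; linear_combination -h3 / 4
  · rw [Complex.mul_im, Complex.neg_im, Complex.one_im]; ring

theorem turnRight_pow_four : turnRight ^ 4 = ⟨-(1 / 2), √3 / 2⟩ := by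
  rw [pow_succ, turnRight_pow_three, turnRight_eq]
  apply Complex.ext <;> simp

theorem turnRight_pow_five : turnRight ^ 5 = ⟨1 / 2, √3 / 2⟩ := by
  rw [pow_succ', turnRight_pow_four, turnRight_eq]
  have h3 : √3 * √3 = 3 := Real.mul_self_sqrt (by norm_num)
  apply Complex.ext
  · rw [Complex.mul_re]; linear_combination h3 / 4
  · rw [Complex.mul_im]; ring

theorem turnRight_pow_mul_conj (k : ℕ) : turnRight ^ k * starRingEnd ℂ (turnRight ^ k) = 1 :=
  mul_conj_of_norm_eq_one (by rw [norm_pow, norm_turnRight, one_pow])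

/-- The side of the line through the edge `A_j A_{j+1}` on which `z` lies: negative values are to
the right. -/
noncomputable def side (A : ℕ → ℂ) (e : ℂ) (j : ℕ) (z : ℂ) : ℝ := leftOf (A j) (e * turnRight ^ j) z

theorem continuous_side (A : ℕ → ℂ) (e : ℂ) (j : ℕ) : Continuous (side A e j) :=
  continuous_leftOf _ _

/-- Abscissa in the frame of the edge `A_v A_{v+1}`. -/
noncomputable def abscissa (A : ℕ → ℂ) (e : ℂ) (v : ℕ) (z : ℂ) : ℝ := along (A v) (e * turnRight ^ v) z

theorem continuous_abscissa (A : ℕ → ℂ) (e : ℂ) (j : ℕ) : Continuous (abscissa A e j) :=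
  continuous_along _ _

/-- A preconnected set meeting a closed set `R` is contained in `R` if it cannot leave it. -/
theorem subset_of_isPreconnected {X : Type*} [TopologicalSpace X] {S R U : Set X}
    (hS : IsPreconnected S) (hR : IsClosed R) (hU : IsOpen U) (h1 : S ∩ R ⊆ U) (h2 : S ∩ U ⊆ R)
    (hne : (S ∩ R).Nonempty) : S ⊆ R := by
  intro x hx
  by_contra hxR
  obtain ⟨y, hy, hyR⟩ := hne
  obtain ⟨z, hz, hzU, hzR⟩ := hS U Rᶜ hU hR.isOpen_compl
    (fun z hz => by
      by_cases h : z ∈ R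
      · exact Or.inl (h1 ⟨hz, h⟩)
      · exact Or.inr h) ⟨y, hy, h1 ⟨hy, hyR⟩⟩ ⟨x, hx, hxR⟩
  exact hzR (h2 ⟨hz, hzU⟩)

/-- Off `Γ` the sets `R` and `U` coincide, so `R` is clopen in the complement of `Γ`; the component
of `z` stays in `R` and is bounded. -/
theorem mem_enclosedRegion {Γ R U : Set ℂ} (hR : IsClosed R) (hb : Bornology.IsBounded R)
    (hU : IsOpen U) (h1 : ∀ z ∈ R, z ∉ Γ → z ∈ U) (h2 : U ⊆ R) {z : ℂ} (hz : z ∈ R) :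
    z ∈ enclosedRegion Γ := by
  by_cases hzΓ : z ∈ Γ
  · exact Or.inl hzΓ
  refine Or.inr ⟨hzΓ, hb.subset ?_⟩
  exact subset_of_isPreconnected isPreconnected_connectedComponentIn hR hU
    (fun w hw => h1 w hw.2 (connectedComponentIn_subset _ _ hw.1)) (fun w hw => h2 hw.2)
    ⟨z, mem_connectedComponentIn hzΓ, hz⟩

section Chain

variable {n : ℕ} {A : ℕ → ℂ} {e : ℂ} {l : ℕ → ℝ}

theorem sqrt_three_pos : 0 < √3 := Real.sqrt_pos.2 (by norm_num)

theorem IsTurningChain.side_add_pow (h : IsTurningChain n A e l) (j k : ℕ) (z : ℂ) (t : ℝ) :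
    side A e j (z + t * (e * turnRight ^ (j + k))) = side A e j z + t * (turnRight ^ k).im := by
  rw [side, pow_add, ← mul_assoc e, leftOf_add (h.norm_dir_pow j), side]

theorem side_self (j : ℕ) : side A e j (A j) = 0 := leftOf_self _ _

theorem IsTurningChain.eq_of_side_eq_zero (h : IsTurningChain n A e l) {j : ℕ} {z : ℂ}
    (hz : side A e j z = 0) : z = A j + (abscissa A e j z : ℂ) * (e * turnRight ^ j) := by
  have h1 := eq_add_along_leftOf (h.norm_dir_pow j) (A j) z
  rw [side] at hz
  rw [hz] at h1
  rw [abscissa]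
  simpa using h1

theorem IsTurningChain.mem_segment (h : IsTurningChain n A e l) {j : ℕ} (hj : j < n) {z : ℂ}
    (hz : side A e j z = 0) (h0 : 0 ≤ abscissa A e j z) (h1 : abscissa A e j z ≤ l j) :
    z ∈ segment ℝ (A j) (A (j + 1)) := by
  have h2 := add_mul_mem_segment (A j) (e * turnRight ^ j) (a := 0) (b := l j)
    (Set.mem_uIcc_of_le h0 h1)
  rw [← h.eq_of_side_eq_zero hz, ← h.succ j hj] at h2
  simpa using h2

/-- On the line of an edge, the next edge bounds the forward end. -/
theorem IsTurningChain.abscissa_le (h : IsTurningChain n A e l) {j : ℕ} (hj : j < n) {z : ℂ}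
    (hz : side A e j z = 0) (h1 : side A e (j + 1) z ≤ 0) : abscissa A e j z ≤ l j := by
  have h2 : z = A (j + 1) + ((abscissa A e j z - l j : ℝ) : ℂ) * (e * turnRight ^ j) := by
    rw [h.succ j hj]
    push_cast
    linear_combination h.eq_of_side_eq_zero hz
  -- Seen from edge `j + 1`, edge `j` points `60°` to the left, so continuing past `A_{j+1}` makes
  -- `side` positive.
  have h3 : e * turnRight ^ j = e * turnRight ^ (j + 1) * starRingEnd ℂ turnRight := by
    have := turnRight_pow_mul_conj 1
    rw [pow_one] at this
    rw [pow_succ]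
    linear_combination -(e * turnRight ^ j) * this
  rw [h3] at h2
  rw [h2, side, leftOf_add (h.norm_dir_pow _), leftOf_self, turnRight_eq] at h1
  simp only [Complex.conj_im, neg_neg, zero_add] at h1
  have := sqrt_three_pos
  nlinarith

/-- On the line of an edge, the previous edge bounds the backward end. -/
theorem IsTurningChain.abscissa_nonneg (h : IsTurningChain n A e l) {j : ℕ} (hj : j + 1 < n)
    {z : ℂ} (hz : side A e (j + 1) z = 0) (h1 : side A e j z ≤ 0) :
    0 ≤ abscissa A e (j + 1) z := by
  rw [h.eq_of_side_eq_zero hz, h.side_add_pow, h.succ j (by omega)] at h1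
  have h2 := h.side_add_pow j 0 (A j) (l j)
  rw [add_zero] at h2
  rw [h2, side_self, pow_one, turnRight_eq] at h1
  simp at h1
  have := sqrt_three_pos
  by_contra hc
  nlinarith

theorem IsTurningChain.mem_segment_of_side (h : IsTurningChain n A e l) {j : ℕ}
    (hj : j + 1 < n) {z : ℂ} (h0 : side A e j z ≤ 0) (hz : side A e (j + 1) z = 0)
    (h1 : side A e (j + 2) z ≤ 0) : z ∈ segment ℝ (A (j + 1)) (A (j + 2)) :=
  h.mem_segment hj hz (h.abscissa_nonneg hj hz h0) (h.abscissa_le hj hz h1)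

/-- A vertex lies to the right of each of the preceding four edges. -/
theorem IsTurningChain.side_nonpos (h : IsTurningChain n A e l) {j k : ℕ} (hk : k ≤ 4)
    (hn : j + k ≤ n) : side A e j (A (j + k)) ≤ 0 := by
  have hs := sqrt_three_pos
  induction k with
  | zero => rw [add_zero, side_self]
  | succ k ih =>
    have h1 := ih (by omega) (by omega)
    have h2 := h.pos (j + k) (by omega)
    rw [← add_assoc, h.succ (j + k) (by omega), h.side_add_pow]
    -- After a total turn of at most `180°` an edge never heads back to the left.
    have h3 : (turnRight ^ k).im ≤ 0 := by
      have hk' : k ≤ 3 := by omega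
      interval_cases k
      · simp
      · rw [pow_one, turnRight_eq]; exact neg_nonpos.2 (by positivity)
      · rw [turnRight_pow_two]; exact neg_nonpos.2 (by positivity)
      · rw [turnRight_pow_three]; simp
    nlinarith

/-- The side of an earlier edge in the frame of a later one. -/
theorem side_eq (A : ℕ → ℂ) (e : ℂ) (j k : ℕ) (z : ℂ) :
    side A e j z =
      (abscissa A e (j + k) z - abscissa A e (j + k) (A j)) * (turnRight ^ k).im +
      (side A e (j + k) z - side A e (j + k) (A j)) * (turnRight ^ k).re := by
  have h1 : (z - A j) * starRingEnd ℂ (e * turnRight ^ j) =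
      ((z - A (j + k)) * starRingEnd ℂ (e * turnRight ^ (j + k)) -
        (A j - A (j + k)) * starRingEnd ℂ (e * turnRight ^ (j + k))) * turnRight ^ k := by
    rw [pow_add, map_mul, map_mul, map_mul]
    linear_combination -(z - A j) * starRingEnd ℂ e * starRingEnd ℂ (turnRight ^ j) *
      turnRight_pow_mul_conj k
  rw [side, leftOf, h1, Complex.mul_im, Complex.sub_re, Complex.sub_im]
  simp only [abscissa, side, along, leftOf]

theorem IsTurningChain.abscissa_add (h : IsTurningChain n A e l) (j k : ℕ) (z : ℂ) (t : ℝ) :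
    abscissa A e (j + k) (z + t * (e * turnRight ^ j)) =
      abscissa A e (j + k) z + t * (turnRight ^ k).re := by
  have h3 : e * turnRight ^ j =
      e * turnRight ^ (j + k) * starRingEnd ℂ (turnRight ^ k) := by
    rw [pow_add]
    linear_combination -(e * turnRight ^ j) * turnRight_pow_mul_conj k
  rw [h3, abscissa, along_add (h.norm_dir_pow _), abscissa, Complex.conj_re]

/-- A chain that starts in the region to the right of the edges `k, …, v` and inside `B`, whose
non-consecutive edges are disjoint and which avoids the part `Q` of the boundary of `B`, never
leaves this region. -/
theorem IsTurningChain.trapped (h : IsTurningChain n A e l) {k v : ℕ}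
    (hkv : k ≤ v) (hv : v ≤ k + 4) {B Bo Q : Set ℂ} (hB : IsClosed B) (hBo : IsOpen Bo)
    (hsub : Bo ⊆ B) (hAv : A v ∈ B)
    (hfirst : ∀ P ∈ B, side A e k P = 0 → side A e (k + 1) P ≤ 0 →
      P ∈ segment ℝ (A k) (A (k + 1)))
    (hQ : ∀ P ∈ B, P ∉ Bo → (∀ j, k ≤ j → j ≤ v → side A e j P ≤ 0) → P ∈ Q)
    (havoid : ∀ m, v ≤ m → m < n → ∀ P ∈ segment ℝ (A m) (A (m + 1)), P ∉ Q)
    (hcross : ∀ i m, i + 1 < m → m < n → ∀ P ∈ segment ℝ (A m) (A (m + 1)),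
      P ∉ segment ℝ (A i) (A (i + 1)))
    {m : ℕ} (hvm : v ≤ m) (hm : m < n) :
    ∀ P ∈ segment ℝ (A m) (A (m + 1)), P ∈ B ∧ ∀ j, k ≤ j → j ≤ m → side A e j P ≤ 0 := by
  have hs := sqrt_three_pos
  have step : ∀ m, v ≤ m → m < n → (A m ∈ B ∧ ∀ j, k ≤ j → j ≤ m → side A e j (A m) ≤ 0) →
      ∀ P ∈ segment ℝ (A m) (A (m + 1)), P ∈ B ∧ ∀ j, k ≤ j → j ≤ m → side A e j P ≤ 0 := by
    intro m hvm hm hAm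
    have hpar : ∀ P ∈ segment ℝ (A m) (A (m + 1)), ∃ t : ℝ, 0 ≤ t ∧
        P = A m + t * (e * turnRight ^ m) := by
      rintro P ⟨α, β, hα, hβ, hαβ, rfl⟩
      refine ⟨β * l m, mul_nonneg hβ (h.pos m hm).le, ?_⟩
      have : (α : ℂ) + β = 1 := by exact_mod_cast hαβ
      rw [h.succ m hm]
      simp only [Complex.real_smul, Complex.ofReal_mul]
      linear_combination A m * this
    have hlast : ∀ P ∈ segment ℝ (A m) (A (m + 1)), side A e m P ≤ 0 := by
      intro P hP
      obtain ⟨t, -, rfl⟩ := hpar P hP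
      have := h.side_add_pow m 0 (A m) t
      rw [add_zero] at this
      rw [this, side_self]; simp
    have hprev : ∀ j, j + 1 = m → ∀ P ∈ segment ℝ (A m) (A (m + 1)), side A e j P ≤ 0 := by
      rintro j rfl P hP
      obtain ⟨t, ht, rfl⟩ := hpar P hP
      have h1 := h.side_nonpos (show 1 ≤ 4 by norm_num) hm.le
      rw [h.side_add_pow, pow_one, turnRight_eq]
      simp only
      nlinarith
    have hR : IsClosed {P | P ∈ B ∧ ∀ j, k ≤ j → j ≤ m → side A e j P ≤ 0} := by
      simp only [Set.ofPred_and, Set.ofPred_forall]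
      exact hB.inter (isClosed_iInter fun j => isClosed_iInter fun _ => isClosed_iInter fun _ =>
        isClosed_le (continuous_side _ _ _) continuous_const)
    -- The two most recent half-planes are omitted: `hlast` and `hprev` show that edge `m` satisfies
    -- them automatically. Every earlier edge is non-consecutive to `m`, so `hcross` makes its
    -- inequality strict.
    have hU : IsOpen (Bo ∩ ⋂ j ∈ Finset.Ico k (m - 1), {P | side A e j P < 0}) :=
      hBo.inter (isOpen_biInter_finset fun j _ =>
        isOpen_lt (continuous_side _ _ _) continuous_const)
    refine subset_of_isPreconnected (convex_segment _ _).isPreconnected hR hU ?_ ?_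
      ⟨A m, left_mem_segment _ _ _, hAm⟩
    · rintro P ⟨hP, hPB, hPs⟩
      refine ⟨?_, ?_⟩
      · by_contra hPo
        exact havoid m hvm hm P hP (hQ P hPB hPo fun j h1 h2 => hPs j h1 (h2.trans hvm))
      · simp only [Set.mem_iInter, Finset.mem_Ico, Set.mem_ofPred_eq]
        rintro j ⟨h1, h2⟩
        refine lt_of_le_of_ne (hPs j h1 (by omega)) fun h0 => ?_
        refine hcross j m (by omega) hm P hP ?_
        rcases h1.eq_or_lt with rfl | h1
        · exact hfirst P hPB h0 (hPs _ (by omega) (by omega))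
        · obtain ⟨i, rfl⟩ : ∃ i, j = i + 1 := ⟨j - 1, by omega⟩
          exact h.mem_segment_of_side (by omega) (hPs _ (by omega) (by omega)) h0
            (hPs _ (by omega) (by omega))
    · rintro P ⟨hP, hPB, hPs⟩
      refine ⟨hsub hPB, fun j h1 h2 => ?_⟩
      simp only [Set.mem_iInter, Finset.mem_Ico, Set.mem_ofPred_eq] at hPs
      rcases Nat.lt_or_ge j (m - 1) with h3 | h3
      · exact (hPs j ⟨h1, h3⟩).le
      · rcases h2.eq_or_lt with rfl | h2
        · exact hlast P hP
        · exact hprev j (by omega) P hP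
  induction m, hvm using Nat.le_induction with
  | base =>
    refine step v le_rfl hm ⟨hAv, fun j h1 h2 => ?_⟩
    obtain ⟨i, rfl⟩ : ∃ i, v = j + i := ⟨v - j, by omega⟩
    exact h.side_nonpos (by omega) hm.le
  | succ m hvm ih =>
    have h1 := ih (by omega) _ (right_mem_segment ℝ _ _)
    refine step (m + 1) (by omega) hm ⟨h1.1, fun j h2 h3 => ?_⟩
    rcases h3.eq_or_lt with rfl | h3
    · rw [side_self]
    · exact h1.2 j h2 (by omega)

end Chain

end SteinerSpiral

/-! ### The enclosed region in the convex and the five-edge case -/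

namespace SteinerSpiral

section Chain

variable {n : ℕ} {A : ℕ → ℂ} {e : ℂ} {l : ℕ → ℝ}

/-- The foot of the perpendicular from `A_u` to the line of the edge `A_v A_{v+1}`. -/
noncomputable def perpFoot (A : ℕ → ℂ) (e : ℂ) (u v : ℕ) : ℂ :=
  A v + (abscissa A e v (A u) : ℂ) * (e * turnRight ^ v)

theorem IsTurningChain.mem_segment_perpFoot_left (h : IsTurningChain n A e l) {u v : ℕ} {z : ℂ}
    (hz : side A e v z = 0) (h0 : 0 ≤ abscissa A e v z)
    (h1 : abscissa A e v z ≤ abscissa A e v (A u)) : z ∈ segment ℝ (A v) (perpFoot A e u v) := by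
  have h2 := add_mul_mem_segment (A v) (e * turnRight ^ v) (Set.mem_uIcc_of_le h0 h1)
  rw [← h.eq_of_side_eq_zero hz] at h2
  simpa [perpFoot] using h2

theorem IsTurningChain.mem_segment_perpFoot_right (h : IsTurningChain n A e l) {u v : ℕ} {z : ℂ}
    (hz : abscissa A e v z = abscissa A e v (A u))
    (h1 : side A e v z ∈ Set.uIcc 0 (side A e v (A u))) :
    z ∈ segment ℝ (perpFoot A e u v) (A u) := by
  have h2 := add_mul_mem_segment (perpFoot A e u v) (Complex.I * (e * turnRight ^ v)) h1
  have h3 : ∀ w, abscissa A e v w = abscissa A e v (A u) →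
      perpFoot A e u v + (side A e v w : ℂ) * (Complex.I * (e * turnRight ^ v)) = w := by
    intro w hw
    conv_rhs => rw [eq_add_along_leftOf (h.norm_dir_pow v) (A v) w]
    rw [perpFoot, ← hw, abscissa, side]
    ring
  rw [h3 z hz, h3 _ rfl] at h2
  simpa using h2

/-- The abscissa is scaled by `√3` because that is what the half-plane inequalities bound linearly.
-/
theorem IsTurningChain.isBounded (h : IsTurningChain n A e l) {v : ℕ} {R : Set ℂ}
    (a b c d : ℝ) (hR : ∀ z ∈ R, a ≤ √3 * abscissa A e v z ∧ √3 * abscissa A e v z ≤ b ∧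
      c ≤ side A e v z ∧ side A e v z ≤ d) : Bornology.IsBounded R := by
  have hs : 1 ≤ √3 := Real.one_le_sqrt.2 (by norm_num)
  rw [isBounded_iff_forall_norm_le]
  refine ⟨‖A v‖ + (|a| + |b| + (|c| + |d|)), fun z hz => ?_⟩
  obtain ⟨h1, h2, h3, h4⟩ := hR z hz
  have hx : |abscissa A e v z| ≤ |a| + |b| := by
    have : |abscissa A e v z| ≤ |√3 * abscissa A e v z| := by
      rw [abs_mul, abs_of_nonneg (by linarith : (0 : ℝ) ≤ √3)]
      nlinarith [abs_nonneg (abscissa A e v z)]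
    refine this.trans (abs_le.2 ⟨?_, ?_⟩)
    · linarith [neg_abs_le a, abs_nonneg b]
    · linarith [le_abs_self b, abs_nonneg a]
  have hy : |side A e v z| ≤ |c| + |d| := by
    refine abs_le.2 ⟨?_, ?_⟩
    · linarith [neg_abs_le c, abs_nonneg d]
    · linarith [le_abs_self d, abs_nonneg c]
  rw [eq_add_along_leftOf (h.norm_dir_pow v) (A v) z]
  refine (norm_add_le _ _).trans (add_le_add le_rfl ?_)
  rw [norm_mul, h.norm_dir_pow, mul_one]
  refine (norm_add_le _ _).trans (add_le_add ?_ ?_)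
  · rwa [Complex.norm_real, Real.norm_eq_abs]
  · rwa [norm_mul, Complex.norm_I, mul_one, Complex.norm_real, Real.norm_eq_abs]

theorem IsTurningChain.abscissa_neg (h : IsTurningChain n A e l) {u : ℕ} (hu : u < n) :
    abscissa A e (u + 1) (A u) < 0 := by
  have h1 := h.abscissa_add u 1 (A u) (l u)
  rw [← h.succ u hu, abscissa, along_self, pow_one, turnRight_eq] at h1
  simp only at h1
  have := h.pos u hu
  linarith

/-- Between two and four edges before the foot: the polygon, cut off at the line of the last edge,
is convex. -/
theorem IsTurningChain.mem_enclosedRegion_of_convex (h : IsTurningChain n A e l) {u r : ℕ}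
    (hr : r ≤ 2) (hv : u + r + 2 < n) {Γ : Set ℂ}
    (hΓ : ∀ i, u ≤ i → i < u + r + 2 → segment ℝ (A i) (A (i + 1)) ⊆ Γ)
    (hΓ₁ : segment ℝ (A (u + r + 2)) (perpFoot A e u (u + r + 2)) ⊆ Γ)
    (hΓ₂ : segment ℝ (perpFoot A e u (u + r + 2)) (A u) ⊆ Γ)
    (hx : 0 ≤ abscissa A e (u + r + 2) (A u))
    (havoid : ∀ m, u + r + 2 ≤ m → m < n → ∀ P ∈ segment ℝ (A m) (A (m + 1)),
      P ∉ segment ℝ (perpFoot A e u (u + r + 2)) (A u))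
    (hcross : ∀ i m, i + 1 < m → m < n → ∀ P ∈ segment ℝ (A m) (A (m + 1)),
      P ∉ segment ℝ (A i) (A (i + 1))) : A n ∈ enclosedRegion Γ := by
  have hs := sqrt_three_pos
  -- Edge `u` runs against the direction of edge `v`, so the condition of not passing the
  -- perpendicular cuts the line of edge `u` at `A_u`.
  have hre : (turnRight ^ (r + 2)).re < 0 := by
    interval_cases r
    · rw [turnRight_pow_two]; norm_num
    · rw [turnRight_pow_three]; norm_num
    · rw [turnRight_pow_four]; norm_num
  have hfirst : ∀ P, abscissa A e (u + r + 2) P ≤ abscissa A e (u + r + 2) (A u) →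
      side A e u P = 0 → side A e (u + 1) P ≤ 0 → P ∈ segment ℝ (A u) (A (u + 1)) := by
    intro P hP h0 h1
    refine h.mem_segment (by omega) h0 ?_ (h.abscissa_le (by omega) h0 h1)
    have h2 := h.abscissa_add u (r + 2) (A u) (abscissa A e u P)
    rw [← h.eq_of_side_eq_zero h0, ← add_assoc] at h2
    by_contra hc
    nlinarith
  have hQ : ∀ P, abscissa A e (u + r + 2) P = abscissa A e (u + r + 2) (A u) →
      side A e u P ≤ 0 → side A e (u + r + 2) P ≤ 0 →
      P ∈ segment ℝ (perpFoot A e u (u + r + 2)) (A u) := by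
    intro P hP h0 h1
    refine h.mem_segment_perpFoot_right hP ?_
    have h2 := side_eq A e u (r + 2) P
    rw [← add_assoc, hP, sub_self, zero_mul, zero_add] at h2
    rw [h2] at h0
    refine Set.mem_uIcc_of_ge ?_ h1
    by_contra hc
    nlinarith
  have hB : IsClosed {z | abscissa A e (u + r + 2) z ≤ abscissa A e (u + r + 2) (A u)} :=
    isClosed_le (continuous_abscissa _ _ _) continuous_const
  have hBo : IsOpen {z | abscissa A e (u + r + 2) z < abscissa A e (u + r + 2) (A u)} :=
    isOpen_lt (continuous_abscissa _ _ _) continuous_const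
  have hAv : abscissa A e (u + r + 2) (A (u + r + 2)) ≤ abscissa A e (u + r + 2) (A u) := by
    rwa [abscissa, along_self]
  obtain ⟨m, rfl⟩ : ∃ m, n = m + 1 := ⟨n - 1, by omega⟩
  obtain ⟨hn1, hn2⟩ := h.trapped (k := u) (v := u + r + 2) (by omega) (by omega) hB hBo
    (fun z hz => by simp only [Set.mem_ofPred_eq] at hz ⊢; exact hz.le) hAv (fun P hP => hfirst P hP)
    (fun P hP hPo hPs => hQ P (le_antisymm hP (not_lt.1 hPo)) (hPs u le_rfl (by omega))
      (hPs _ (by omega) le_rfl)) havoid hcross (show u + r + 2 ≤ m by omega) (by omega)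
    _ (right_mem_segment ℝ _ _)
  refine mem_enclosedRegion
    (R := {z | abscissa A e (u + r + 2) z ≤ abscissa A e (u + r + 2) (A u)} ∩
      ⋂ j ∈ Finset.Icc u (u + r + 2), {z | side A e j z ≤ 0})
    (U := {z | abscissa A e (u + r + 2) z < abscissa A e (u + r + 2) (A u)} ∩
      ⋂ j ∈ Finset.Icc u (u + r + 2), {z | side A e j z < 0}) ?_ ?_ ?_ ?_ ?_ ?_
  · exact hB.inter (isClosed_biInter fun j _ =>
      isClosed_le (continuous_side _ _ _) continuous_const)
  -- The half-planes of the last three edges and of the perpendicular already bound the region.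
  -- Adding the inequalities of edges `u + r` and `u + r + 1` gives the left bound; the former with
  -- the right bound gives the lower one.
  · refine h.isBounded (v := u + r + 2)
      ((√3 * abscissa A e (u + r + 2) (A (u + r + 1)) +
        √3 * abscissa A e (u + r + 2) (A (u + r)) + side A e (u + r + 2) (A (u + r)) -
        side A e (u + r + 2) (A (u + r + 1))) / 2)
      (√3 * abscissa A e (u + r + 2) (A u))
      (side A e (u + r + 2) (A (u + r)) + √3 * abscissa A e (u + r + 2) (A (u + r)) -
        √3 * abscissa A e (u + r + 2) (A u)) 0 ?_
    rintro z ⟨h1, h2⟩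
    simp only [Set.mem_iInter, Finset.mem_Icc, Set.mem_ofPred_eq] at h1 h2
    have s0 := h2 (u + r + 2) ⟨by omega, by omega⟩
    have s1 := h2 (u + r + 1) ⟨by omega, by omega⟩
    have s2 := h2 (u + r) ⟨by omega, by omega⟩
    rw [side_eq A e (u + r + 1) 1, pow_one, turnRight_eq] at s1
    rw [side_eq A e (u + r) 2, turnRight_pow_two] at s2
    simp only [add_assoc, Nat.reduceAdd] at s0 s1 s2 h1 ⊢
    have h3 := mul_le_mul_of_nonneg_left h1 hs.le
    refine ⟨?_, ?_, ?_, ?_⟩ <;> nlinarith only [s0, s1, s2, h3]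
  · exact hBo.inter (isOpen_biInter_finset fun j _ =>
      isOpen_lt (continuous_side _ _ _) continuous_const)
  · rintro z ⟨h1, h2⟩ hz
    simp only [Set.mem_iInter, Finset.mem_Icc, Set.mem_ofPred_eq] at h1 h2
    refine ⟨lt_of_le_of_ne h1 fun h0 => hz (hΓ₂ (hQ z h0 (h2 u ⟨le_rfl, by omega⟩)
      (h2 _ ⟨by omega, le_rfl⟩))), ?_⟩
    simp only [Set.mem_iInter, Finset.mem_Icc, Set.mem_ofPred_eq]
    rintro j ⟨hj1, hj2⟩
    refine lt_of_le_of_ne (h2 j ⟨hj1, hj2⟩) fun h0 => hz ?_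
    rcases hj1.eq_or_lt with rfl | hj1
    · exact hΓ u le_rfl (by omega) (hfirst z h1 h0 (h2 _ ⟨by omega, by omega⟩))
    · obtain ⟨i, rfl⟩ : ∃ i, j = i + 1 := ⟨j - 1, by omega⟩
      rcases hj2.eq_or_lt with hj2 | hj2
      · obtain rfl : i = u + r + 1 := by omega
        exact hΓ₁ (h.mem_segment_perpFoot_left h0
          (h.abscissa_nonneg (by omega) h0 (h2 _ ⟨by omega, by omega⟩)) h1)
      · exact hΓ (i + 1) (by omega) hj2 (h.mem_segment_of_side (by omega)
          (h2 _ ⟨by omega, by omega⟩) h0 (h2 _ ⟨by omega, by omega⟩))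
  · rintro z ⟨h1, h2⟩
    simp only [Set.mem_iInter, Finset.mem_Icc, Set.mem_ofPred_eq] at h1 h2
    refine ⟨h1.le, ?_⟩
    simp only [Set.mem_iInter, Finset.mem_Icc, Set.mem_ofPred_eq]
    exact fun j hj => (h2 j hj).le
  · refine ⟨hn1, ?_⟩
    simp only [Set.mem_iInter, Finset.mem_Icc, Set.mem_ofPred_eq]
    exact fun j hj => hn2 j hj.1 (by omega)

/-- Five edges before the foot: the region is the part to the right of the last edges which is
bounded by the first edge and the perpendicular. -/
theorem IsTurningChain.mem_enclosedRegion_of_five (h : IsTurningChain n A e l) {u : ℕ}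
    (hv : u + 5 < n) {Γ : Set ℂ}
    (hΓ : ∀ i, u ≤ i → i < u + 5 → segment ℝ (A i) (A (i + 1)) ⊆ Γ)
    (hΓ₁ : segment ℝ (A (u + 5)) (perpFoot A e u (u + 5)) ⊆ Γ)
    (hΓ₂ : segment ℝ (perpFoot A e u (u + 5)) (A u) ⊆ Γ)
    (hx : 0 ≤ abscissa A e (u + 5) (A u))
    (havoid : ∀ m, u + 5 ≤ m → m < n → ∀ P ∈ segment ℝ (A m) (A (m + 1)),
      P ∉ segment ℝ (perpFoot A e u (u + 5)) (A u))
    (hcross : ∀ i m, i + 1 < m → m < n → ∀ P ∈ segment ℝ (A m) (A (m + 1)),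
      P ∉ segment ℝ (A i) (A (i + 1))) : A n ∈ enclosedRegion Γ := by
  have hs := sqrt_three_pos
  have hlu := h.pos u (by omega)
  set x := abscissa A e (u + 5) with hxdef
  set y := side A e (u + 5) with hydef
  have hcx : Continuous x := continuous_abscissa _ _ _
  have hcy : Continuous y := continuous_side _ _ _
  have hcs : Continuous (side A e u) := continuous_side _ _ _
  have hside : ∀ z, side A e u z = (x z - x (A u)) * (√3 / 2) + (y z - y (A u)) * (1 / 2) := by
    intro z
    have := side_eq A e u 5 z
    rwa [turnRight_pow_five] at this
  have hside₁ : ∀ z, side A e (u + 1) z =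
      (x z - x (A (u + 1))) * (√3 / 2) + (y z - y (A (u + 1))) * (-(1 / 2)) := by
    intro z
    have := side_eq A e (u + 1) 4 z
    rwa [turnRight_pow_four] at this
  have hsegu : ∀ P, x (A u) ≤ x P → side A e u P = 0 → side A e (u + 1) P ≤ 0 →
      P ∈ segment ℝ (A u) (A (u + 1)) := by
    intro P hP h0 h1
    refine h.mem_segment (by omega) h0 ?_ (h.abscissa_le (by omega) h0 h1)
    have h2 := h.abscissa_add u 5 (A u) (abscissa A e u P)
    rw [← h.eq_of_side_eq_zero h0, turnRight_pow_five] at h2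
    simp only at h2
    linarith
  -- `A_{u+1}` lies beyond the perpendicular and edge `u + 1` heads back, so a point of its line
  -- with `x P ≤ x (A u)` is past `A_{u+1}`.
  have hfirst : ∀ P, (x P ≤ x (A u) ∨ side A e u P ≤ 0) →
      side A e (u + 1) P = 0 → side A e (u + 2) P ≤ 0 →
      P ∈ segment ℝ (A (u + 1)) (A (u + 2)) := by
    intro P hP h0 h1
    rcases hP with hP | hP
    · refine h.mem_segment (by omega) h0 ?_ (h.abscissa_le (by omega) h0 h1)
      have h2 := h.abscissa_add (u + 1) 4 (A (u + 1)) (abscissa A e (u + 1) P)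
      have h3 := h.abscissa_add u 5 (A u) (l u)
      rw [← h.succ u (by omega), turnRight_pow_five] at h3
      rw [← h.eq_of_side_eq_zero h0, turnRight_pow_four] at h2
      simp only [add_assoc, Nat.reduceAdd, ← hxdef] at h2 h3
      linarith
    · exact h.mem_segment_of_side (by omega) hP h0 h1
  have hQ : ∀ P, x P = x (A u) → 0 ≤ side A e u P → y P ≤ 0 →
      P ∈ segment ℝ (perpFoot A e u (u + 5)) (A u) := by
    intro P hP h0 h1
    refine h.mem_segment_perpFoot_right hP (Set.mem_uIcc_of_ge ?_ h1)
    rw [hside, hP] at h0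
    linarith
  have hQ' : ∀ P, x P = x (A u) → side A e u P ≤ 0 → 0 ≤ y P →
      P ∈ segment ℝ (perpFoot A e u (u + 5)) (A u) := by
    intro P hP h0 h1
    refine h.mem_segment_perpFoot_right hP (Set.mem_uIcc_of_le h1 ?_)
    rw [hside, hP] at h0
    linarith
  have hbase : ∀ P, y P = 0 → side A e (u + 4) P ≤ 0 → x P ≤ x (A u) →
      P ∈ segment ℝ (A (u + 5)) (perpFoot A e u (u + 5)) := fun P h0 h1 h2 =>
    h.mem_segment_perpFoot_left h0 (h.abscissa_nonneg (j := u + 4) (by omega) h0 h1) h2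
  -- A union of half-planes: when `A_u` lies to the right of the last edge, the interior angle at
  -- `A_u` is reflex. The boundary set `Q` below accordingly contains edge `u` as well as the
  -- perpendicular.
  have hB : IsClosed {z | x z ≤ x (A u) ∨ side A e u z ≤ 0} := by
    rw [Set.ofPred_or]
    exact (isClosed_le hcx continuous_const).union (isClosed_le hcs continuous_const)
  have hBo : IsOpen {z | x z < x (A u) ∨ side A e u z < 0} := by
    rw [Set.ofPred_or]
    exact (isOpen_lt hcx continuous_const).union (isOpen_lt hcs continuous_const)
  have hAv : x (A (u + 5)) ≤ x (A u) ∨ side A e u (A (u + 5)) ≤ 0 := by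
    left
    rwa [hxdef, abscissa, along_self]
  obtain ⟨m, rfl⟩ : ∃ m, n = m + 1 := ⟨n - 1, by omega⟩
  obtain ⟨hn1, hn2⟩ := h.trapped (k := u + 1) (v := u + 5) (by omega) (by omega) hB hBo
    (Q := segment ℝ (perpFoot A e u (u + 5)) (A u) ∪ segment ℝ (A u) (A (u + 1)))
    (fun z hz => Or.imp le_of_lt le_of_lt hz) hAv (fun P hP => hfirst P hP)
    (fun P hP hPo hPs => by
      have hPo' : ¬ (x P < x (A u) ∨ side A e u P < 0) := hPo
      have hP' : x P ≤ x (A u) ∨ side A e u P ≤ 0 := hP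
      push Not at hPo'
      rcases hP' with hP' | hP'
      · exact Or.inl (hQ P (le_antisymm hP' hPo'.1) hPo'.2 (hPs _ (by omega) le_rfl))
      · exact Or.inr (hsegu P hPo'.1 (le_antisymm hP' hPo'.2) (hPs _ le_rfl (by omega))))
    (fun m h1 h2 P hP hPQ => hPQ.elim (havoid m h1 h2 P hP) (hcross u m (by omega) h2 P hP))
    hcross (show u + 5 ≤ m by omega) (by omega) _ (right_mem_segment ℝ _ _)
  have hseg : ∀ z, (x z ≤ x (A u) ∨ side A e u z ≤ 0) → side A e (u + 1) z ≤ 0 →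
      side A e (u + 2) z ≤ 0 → side A e (u + 3) z ≤ 0 → side A e (u + 4) z ≤ 0 → y z ≤ 0 →
      z ∉ Γ → side A e (u + 1) z < 0 ∧ side A e (u + 2) z < 0 ∧ side A e (u + 3) z < 0 ∧
        side A e (u + 4) z < 0 := by
    intro z h0 h1 h2 h3 h4 h5 hz
    refine ⟨lt_of_le_of_ne h1 fun hc => hz ?_, lt_of_le_of_ne h2 fun hc => hz ?_,
      lt_of_le_of_ne h3 fun hc => hz ?_, lt_of_le_of_ne h4 fun hc => hz ?_⟩
    · exact hΓ (u + 1) (by omega) (by omega) (hfirst z h0 hc h2)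
    · exact hΓ (u + 2) (by omega) (by omega) (h.mem_segment_of_side (by omega) h1 hc h3)
    · exact hΓ (u + 3) (by omega) (by omega) (h.mem_segment_of_side (by omega) h2 hc h4)
    · exact hΓ (u + 4) (by omega) (by omega) (h.mem_segment_of_side (by omega) h3 hc h5)
  have hx5 : x (A (u + 5)) = 0 := along_self _ _
  have hy5 : y (A (u + 5)) = 0 := leftOf_self _ _
  have f2 : ∀ z, side A e (u + 2) z = side A e (u + 2) (A (u + 5)) - y z := by
    intro z
    have h1 := side_eq A e (u + 2) 3 z
    have h2 := side_eq A e (u + 2) 3 (A (u + 5))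
    rw [turnRight_pow_three] at h1 h2
    simp only [add_assoc, Nat.reduceAdd, ← hxdef, ← hydef, hx5, hy5, Complex.neg_re,
      Complex.neg_im, Complex.one_re, Complex.one_im] at h1 h2
    linarith
  have f3 : ∀ z, side A e (u + 3) z =
      side A e (u + 3) (A (u + 5)) - √3 * x z / 2 - y z / 2 := by
    intro z
    have h1 := side_eq A e (u + 3) 2 z
    have h2 := side_eq A e (u + 3) 2 (A (u + 5))
    rw [turnRight_pow_two] at h1 h2
    simp only [add_assoc, Nat.reduceAdd, ← hxdef, ← hydef, hx5, hy5] at h1 h2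
    linarith
  have f4 : ∀ z, side A e (u + 4) z =
      side A e (u + 4) (A (u + 5)) - √3 * x z / 2 + y z / 2 := by
    intro z
    have h1 := side_eq A e (u + 4) 1 z
    have h2 := side_eq A e (u + 4) 1 (A (u + 5))
    rw [pow_one, turnRight_eq] at h1 h2
    simp only [add_assoc, Nat.reduceAdd, ← hxdef, ← hydef, hx5, hy5] at h1 h2
    linarith
  have n2 : side A e (u + 2) (A (u + 5)) ≤ 0 := h.side_nonpos (k := 3) (by omega) (by omega)
  have n3 : side A e (u + 3) (A (u + 5)) ≤ 0 := h.side_nonpos (k := 2) (by omega) (by omega)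
  have n4 : side A e (u + 4) (A (u + 5)) ≤ 0 := h.side_nonpos (k := 1) (by omega) (by omega)
  -- The second piece of `R` is the triangle between the perpendicular, edge `u` and the line of the
  -- last edge, which matters when `A_u` is to the left of that line. The middle piece of `U` joins
  -- it to the first across the opening beyond `H`, which is not part of the curve.
  refine mem_enclosedRegion
    (R := {z | y z ≤ 0 ∧ side A e (u + 1) z ≤ 0 ∧ side A e (u + 2) z ≤ 0 ∧
        side A e (u + 3) z ≤ 0 ∧ side A e (u + 4) z ≤ 0 ∧ (x z ≤ x (A u) ∨ side A e u z ≤ 0)} ∪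
      {z | 0 ≤ y z ∧ x (A u) ≤ x z ∧ side A e u z ≤ 0 ∧ side A e (u + 1) z ≤ 0})
    (U := {z | y z < 0 ∧ side A e (u + 1) z < 0 ∧ side A e (u + 2) z < 0 ∧
        side A e (u + 3) z < 0 ∧ side A e (u + 4) z < 0 ∧ (x z < x (A u) ∨ side A e u z < 0)} ∪
      ({z | x (A u) < x z ∧ side A e u z < 0 ∧ side A e (u + 1) z < 0 ∧ side A e (u + 2) z < 0 ∧
        side A e (u + 3) z < 0 ∧ side A e (u + 4) z < 0} ∪
      {z | 0 < y z ∧ x (A u) < x z ∧ side A e u z < 0 ∧ side A e (u + 1) z < 0})) ?_ ?_ ?_ ?_ ?_ ?_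
  · have hc : ∀ j, IsClosed {z | side A e j z ≤ 0} := fun j =>
      isClosed_le (continuous_side _ _ _) continuous_const
    exact ((isClosed_le hcy continuous_const).inter <| (hc _).inter <| (hc _).inter <|
      (hc _).inter <| (hc _).inter hB).union <| (isClosed_le continuous_const hcy).inter <|
      (isClosed_le continuous_const hcx).inter <| (hc _).inter (hc _)
  · refine h.isBounded (v := u + 5)
      (min (side A e (u + 3) (A (u + 5)) + side A e (u + 4) (A (u + 5))) (√3 * x (A u)))
      (max (√3 * x (A (u + 1)) - y (A (u + 1))) (√3 * x (A u) + y (A u)))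
      (min (side A e (u + 2) (A (u + 5))) 0) (max 0 (y (A u))) ?_
    rintro z (⟨h0, h1, h2, h3, h4, -⟩ | ⟨h0, h1, h2, -⟩)
    · rw [hside₁] at h1
      rw [f2] at h2
      rw [f3] at h3
      rw [f4] at h4
      refine ⟨(min_le_left _ _).trans ?_, le_trans ?_ (le_max_left _ _),
        (min_le_left _ _).trans ?_, le_trans ?_ (le_max_left _ _)⟩
      · change _ ≤ √3 * x z; linarith
      · change √3 * x z ≤ _; linarith
      · change _ ≤ y z; linarith
      · exact h0
    · rw [hside] at h2
      have h3 := mul_le_mul_of_nonneg_left h1 hs.le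
      refine ⟨(min_le_right _ _).trans ?_, le_trans ?_ (le_max_right _ _),
        (min_le_right _ _).trans ?_, le_trans ?_ (le_max_right _ _)⟩
      · exact h3
      · change √3 * x z ≤ _; linarith
      · exact h0
      · change y z ≤ _; linarith
  · have ho : ∀ j, IsOpen {z | side A e j z < 0} := fun j =>
      isOpen_lt (continuous_side _ _ _) continuous_const
    have hox : IsOpen {z | x (A u) < x z} := isOpen_lt continuous_const hcx
    exact ((isOpen_lt hcy continuous_const).inter <| (ho _).inter <| (ho _).inter <|
      (ho _).inter <| (ho _).inter hBo).union <| (hox.inter <| (ho _).inter <| (ho _).inter <|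
      (ho _).inter <| (ho _).inter (ho _)).union <| (isOpen_lt continuous_const hcy).inter <|
      hox.inter <| (ho _).inter (ho _)
  · have hzero : ∀ z, y z = 0 → side A e (u + 1) z ≤ 0 → x (A u) ≤ x z → side A e u z ≤ 0 →
        z ∉ Γ → x (A u) < x z ∧ side A e u z < 0 ∧ side A e (u + 1) z < 0 ∧
          side A e (u + 2) z < 0 ∧ side A e (u + 3) z < 0 ∧ side A e (u + 4) z < 0 := by
      intro z h0 h1 hxz hu hz
      have hp : 0 ≤ √3 * x z := mul_nonneg hs.le (hx.trans hxz)
      have g4 : side A e (u + 4) z ≤ 0 := by rw [f4, h0]; linarith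
      exact ⟨lt_of_le_of_ne hxz fun hc => hz (hΓ₁ (hbase z h0 g4 hc.ge)),
        lt_of_le_of_ne hu fun hc => hz (hΓ u le_rfl (by omega) (hsegu z hxz hc h1)),
        hseg z (Or.inr hu) h1 (by rw [f2, h0]; linarith) (by rw [f3, h0]; linarith) g4 h0.le hz⟩
    rintro z (⟨h0, h1, h2, h3, h4, h5⟩ | ⟨h0, h1, h2, h3⟩) hz
    · rcases h0.eq_or_lt with h0' | h0'
      · rcases le_or_gt (x z) (x (A u)) with hxz | hxz
        · exact absurd (hΓ₁ (hbase z h0' h4 hxz)) hz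
        · exact Or.inr (Or.inl (hzero z h0' h1 hxz.le (h5.resolve_left hxz.not_ge) hz))
      · obtain ⟨g1, g2, g3, g4⟩ := hseg z h5 h1 h2 h3 h4 h0 hz
        refine Or.inl ⟨h0', g1, g2, g3, g4, ?_⟩
        by_contra hc
        push Not at hc
        rcases h5 with h5 | h5
        · exact hz (hΓ₂ (hQ z (le_antisymm h5 hc.1) hc.2 h0))
        · exact hz (hΓ u le_rfl (by omega) (hsegu z hc.1 (le_antisymm h5 hc.2) h1))
    · rcases h0.eq_or_lt with h0' | h0'
      · exact Or.inr (Or.inl (hzero z h0'.symm h3 h1 h2 hz))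
      · refine Or.inr (Or.inr ⟨h0', lt_of_le_of_ne h1 fun hc => hz ?_,
          lt_of_le_of_ne h2 fun hc => hz ?_, lt_of_le_of_ne h3 fun hc => hz ?_⟩)
        · exact hΓ₂ (hQ' z hc.symm h2 h0)
        · exact hΓ u le_rfl (by omega) (hsegu z h1 hc h3)
        · exact hΓ (u + 1) (by omega) (by omega)
            (hfirst z (Or.inr h2) hc (by rw [f2]; linarith))
  · rintro z (⟨h0, h1, h2, h3, h4, h5⟩ | ⟨h0, h1, h2, h3, h4, h5⟩ | ⟨h0, h1, h2, h3⟩)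
    · exact Or.inl ⟨h0.le, h1.le, h2.le, h3.le, h4.le, h5.imp le_of_lt le_of_lt⟩
    · rcases le_total (y z) 0 with hy | hy
      · exact Or.inl ⟨hy, h2.le, h3.le, h4.le, h5.le, Or.inr h1.le⟩
      · exact Or.inr ⟨hy, h0.le, h1.le, h2.le⟩
    · exact Or.inr ⟨h0.le, h1.le, h2.le, h3.le⟩
  · exact Or.inl ⟨hn2 _ (by omega) (by omega), hn2 _ (by omega) (by omega),
      hn2 _ (by omega) (by omega), hn2 _ (by omega) (by omega), hn2 _ (by omega) (by omega), hn1⟩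

end Chain

end SteinerSpiral

/-! ### Conclusion -/

namespace SteinerSpiral

/-- The end of a spiral chain of a minimal network lies in the polygonal region of every Type B
condition that holds. -/
theorem IsSpiralChain.mem_polygonRegion {V : Finset ℂ} {N : Network V} {n : ℕ} {A : ℕ → ℂ}
    (hN : N.IsSteinerMinimalTree) (hA : IsSpiralChain N n A) {t : Index} (ht : t ∈ indexB n)
    (h : CondB A t) : A n ∈ polygonRegion A t := by
  have c := hA.isTurningChain
  obtain ⟨u, v, s⟩ := t
  obtain ⟨h1, h2, h3⟩ := ht
  simp only at h1 h2 h3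
  have hv6 : v < 6 := lt_of_lt_of_le h3 (min_le_left _ _)
  have hvn : v < n := lt_of_lt_of_le h3 (min_le_right _ _)
  have hfoot : foot A ⟨u, v, s⟩ = perpFoot A (A 1 - A 0) u v :=
    foot_eq (t := ⟨u, v, s⟩) (c.norm_dir_pow v) (c.pos v hvn) (c.succ v hvn)
  have hx : 0 ≤ abscissa A (A 1 - A 0) v (A u) :=
    ((condB_iff (t := ⟨u, v, s⟩) (c.norm_dir_pow v) (c.pos v hvn) (c.succ v hvn)).1 h).1
  have hdist : dist (A u) (perpFoot A (A 1 - A 0) u v) < edgeLengths A s := hfoot ▸ h.2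
  have hΓ : ∀ i, u ≤ i → i < v → segment ℝ (A i) (A (i + 1)) ⊆ polygonCurve A ⟨u, v, s⟩ :=
    fun i hi hi' z hz => Or.inl (Or.inl (Set.mem_biUnion (Set.mem_Ico.2 ⟨hi, hi'⟩) hz))
  have hΓ₁ : segment ℝ (A v) (perpFoot A (A 1 - A 0) u v) ⊆ polygonCurve A ⟨u, v, s⟩ := by
    rw [← hfoot]; exact fun z hz => Or.inl (Or.inr hz)
  have hΓ₂ : segment ℝ (perpFoot A (A 1 - A 0) u v) (A u) ⊆ polygonCurve A ⟨u, v, s⟩ := by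
    rw [← hfoot]; exact fun z hz => Or.inr hz
  have havoid : ∀ m, v ≤ m → m < n → ∀ P ∈ segment ℝ (A m) (A (m + 1)),
      P ∉ segment ℝ (perpFoot A (A 1 - A 0) u v) (A u) := by
    intro m hvm hm P hP hP'
    obtain ⟨i, rfl⟩ : ∃ i, s = i + 1 := ⟨s - 1, by omega⟩
    have g1 : edgeLengths A (i + 1) ≤ dist (A u) P :=
      hA.dist_le_dist_of_mem_segment hN (by omega) (by omega) hm hP
    have g2 := dist_add_dist_of_mem_segment hP'
    have g3 : 0 ≤ dist (perpFoot A (A 1 - A 0) u v) P := dist_nonneg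
    rw [dist_comm P, dist_comm _ (A u)] at g2
    linarith
  have hcross : ∀ i m, i + 1 < m → m < n → ∀ P ∈ segment ℝ (A m) (A (m + 1)),
      P ∉ segment ℝ (A i) (A (i + 1)) := fun i m him hm P hP => hA.disjoint_segments hN him hm hP
  obtain ⟨k, rfl⟩ : ∃ k, v = u + k + 1 := ⟨v - u - 1, by omega⟩
  -- Here `k = v - u - 1`, and `v < 6` leaves only `k ≤ 4`.
  rcases Nat.eq_zero_or_pos k with rfl | hk
  · exact absurd hx (c.abscissa_neg (u := u) (by omega)).not_ge
  rcases Nat.lt_or_ge k 4 with hk4 | hk4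
  · obtain ⟨r, rfl⟩ : ∃ r, k = r + 1 := ⟨k - 1, by omega⟩
    exact c.mem_enclosedRegion_of_convex (by omega) hvn hΓ hΓ₁ hΓ₂ hx havoid hcross
  · obtain rfl : k = 4 := by omega
    exact c.mem_enclosedRegion_of_five hvn hΓ hΓ₁ hΓ₂ hx havoid hcross

end SteinerSpiral

theorem mainTheorem4 (n : ℕ)
    (SA SB : Set SteinerSpiral.Index)
    (hSA : SA ⊆ SteinerSpiral.indexA n) (hSB : SB ⊆ SteinerSpiral.indexB n)
    (C : Set (ℕ → ℝ)) (hC : SteinerSpiral.IsLinearConstraint n C)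
    (himp : ∀ a ∈ SteinerSpiral.edgeVectors n, a ∈ C →
      (∀ t ∈ SA, SteinerSpiral.CondA (SteinerSpiral.spiral a) t) →
      ∃ t ∈ SB, SteinerSpiral.CondB (SteinerSpiral.spiral a) t)
    (V : Finset ℂ) (N : SteinerSpiral.Network V) (hN : N.IsSteinerMinimalTree)
    (A : ℕ → ℂ) (hA : SteinerSpiral.IsSpiralChain N n A)
    (hw : SteinerSpiral.edgeLengths A ∈ C) :
    (∃ t ∈ SB, SteinerSpiral.CondB A t) ∧
      ∀ t ∈ SB, SteinerSpiral.CondB A t → A n ∈ SteinerSpiral.polygonRegion A t := by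
  refine ⟨?_, fun t ht h => hA.mem_polygonRegion hN (hSB ht) h⟩
  obtain ⟨t, ht, h⟩ := himp _ hA.edgeLengths_mem hw fun t ht => hA.condA_spiral hN (hSA ht)
  exact ⟨t, ht, hA.condB_of_spiral (hSB ht) h⟩
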